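/- Let $d\in\{2,3\}$ and let $\Omega\subset\mathbb R^d$ be a domain, i.e. a nonempty connected open set. Let $\Omega_1,\dots,\Omega_{m'}$ be pairwise disjoint measurable subsets of $\Omega$ whose union is $\Omega$ up to a set of Lebesgue measure zero. Let $b\in L^\infty(\Omega;\mathbb R^d)$ and $f\in L^2(\Omega)$. Let $V:=H^1(\Omega)$ be the space of all $y\in L^2(\Omega)$ that have a weak gradient $\nabla y\in L^2(\Omega;\mathbb R^d)$. For a parameter $u=(\kappa,c,r)\in\mathbb R^{m'}\times\mathbb R\times\mathbb R$ and $y,\varphi\in V$ put $$a(u;y,\varphi):=\sum_{i=1}^{m'}\kappa_i\int_{\Omega_i}\nabla y\cdot\nabla\varphi\,dx+c\int_\Omega (b\cdot\nabla y)\,\varphi\,dx+r\int_\Omega y\,\varphi\,dx,\qquad F(\varphi):=\int_\Omega f\,\varphi\,dx .$$ Then there are $\kappa_{\min}\in(0,\infty)^{m'}$, $c_{\min},c_{\max}\in\mathbb R$ with $c_{\min}<c_{\max}$, and $r_{\min}\in(0,\infty)$ such that, for every parameter $u=(\kappa,c,r)$ with $\kappa_i>\kappa_{\min,i}$ for all $i\in\{1,\dots,m'\}$,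 $c_{\min}<c<c_{\max}$ and $r>r_{\min}$, there is exactly one $y=y(u)\in V$ with $$a(u;y,\varphi)=F(\varphi)\qquad\text{for all }\varphi\in V,$$ that is, the weak form of the advection–diffusion–reaction problem with homogeneous Neumann boundary conditions has a unique solution in $V$. -/

import Mathlib

open MeasureTheory
open scoped ContDiff

noncomputable section

/-- `L²(Ω)`, for the Lebesgue measure on `ℝᵈ`. -/
abbrev L2 {d : ℕ} (Ω : Set (EuclideanSpace ℝ (Fin d))) : Type :=
  Lp ℝ 2 (volume.restrict Ω)

/-- `L²(Ω; ℝᵈ)`. -/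
abbrev L2Vec {d : ℕ} (Ω : Set (EuclideanSpace ℝ (Fin d))) : Type :=
  Lp (EuclideanSpace ℝ (Fin d)) 2 (volume.restrict Ω)

/-- `L^∞(Ω; ℝᵈ)`. -/
abbrev LinftyVec {d : ℕ} (Ω : Set (EuclideanSpace ℝ (Fin d))) : Type :=
  Lp (EuclideanSpace ℝ (Fin d)) ⊤ (volume.restrict Ω)

/-- Test functions `C_c^∞(Ω)`: smooth functions with compact support contained in `Ω`. -/
structure IsTestFunction {d : ℕ} (Ω : Set (EuclideanSpace ℝ (Fin d)))
    (θ : EuclideanSpace ℝ (Fin d) → ℝ) : Prop where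
  smooth : ContDiff ℝ ∞ θ
  compactSupport : HasCompactSupport θ
  support_subset : tsupport θ ⊆ Ω

/-- The partial derivative `∂θ/∂xᵢ`. -/
def partialDeriv {d : ℕ} (i : Fin d) (θ : EuclideanSpace ℝ (Fin d) → ℝ)
    (x : EuclideanSpace ℝ (Fin d)) : ℝ :=
  fderiv ℝ θ x (EuclideanSpace.single i 1)

/-- `g ∈ L²(Ω; ℝᵈ)` is the weak gradient of `y ∈ L²(Ω)`:
`∫_Ω y ∂ᵢθ dx = - ∫_Ω gᵢ θ dx` for all `θ ∈ C_c^∞(Ω)` and all `i`. -/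
def HasWeakGradient {d : ℕ} {Ω : Set (EuclideanSpace ℝ (Fin d))}
    (y : L2 Ω) (g : L2Vec Ω) : Prop :=
  ∀ θ : EuclideanSpace ℝ (Fin d) → ℝ, IsTestFunction Ω θ → ∀ i : Fin d,
    ∫ x in Ω, y x * partialDeriv i θ x = - ∫ x in Ω, g x i * θ x

theorem IsTestFunction.memLp {d : ℕ} {Ω : Set (EuclideanSpace ℝ (Fin d))}
    {θ : EuclideanSpace ℝ (Fin d) → ℝ} (h : IsTestFunction Ω θ) :
    MemLp θ 2 (volume.restrict Ω) :=
  (h.smooth.continuous.memLp_of_hasCompactSupport h.compactSupport).restrict Ω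

theorem IsTestFunction.memLp_partialDeriv {d : ℕ} {Ω : Set (EuclideanSpace ℝ (Fin d))}
    {θ : EuclideanSpace ℝ (Fin d) → ℝ} (h : IsTestFunction Ω θ) (i : Fin d) :
    MemLp (partialDeriv i θ) 2 (volume.restrict Ω) := by
  have hc : Continuous (partialDeriv i θ) :=
    (h.smooth.continuous_fderiv (by simp)).clm_apply continuous_const
  have hs : HasCompactSupport (partialDeriv i θ) := h.compactSupport.fderiv_apply ℝ _
  exact (hc.memLp_of_hasCompactSupport hs).restrict Ω

theorem L2Vec.memLp_coord {d : ℕ} {Ω : Set (EuclideanSpace ℝ (Fin d))}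
    (g : L2Vec Ω) (i : Fin d) : MemLp (fun x => g x i) 2 (volume.restrict Ω) :=
  (EuclideanSpace.proj (𝕜 := ℝ) i : EuclideanSpace ℝ (Fin d) →L[ℝ] ℝ).comp_memLp' (Lp.memLp g)

theorem IsTestFunction.integrable_left {d : ℕ} {Ω : Set (EuclideanSpace ℝ (Fin d))}
    {θ : EuclideanSpace ℝ (Fin d) → ℝ} (h : IsTestFunction Ω θ) (y : L2 Ω) (i : Fin d) :
    Integrable (fun x => y x * partialDeriv i θ x) (volume.restrict Ω) :=
  (Lp.memLp y).integrable_mul (h.memLp_partialDeriv i)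

theorem IsTestFunction.integrable_right {d : ℕ} {Ω : Set (EuclideanSpace ℝ (Fin d))}
    {θ : EuclideanSpace ℝ (Fin d) → ℝ} (h : IsTestFunction Ω θ) (g : L2Vec Ω) (i : Fin d) :
    Integrable (fun x => g x i * θ x) (volume.restrict Ω) :=
  (L2Vec.memLp_coord g i).integrable_mul h.memLp

theorem HasWeakGradient.add {d : ℕ} {Ω : Set (EuclideanSpace ℝ (Fin d))}
    {y z : L2 Ω} {g h : L2Vec Ω} (hy : HasWeakGradient y g) (hz : HasWeakGradient z h) :
    HasWeakGradient (y + z) (g + h) := by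
  intro θ hθ i
  have e1 : ∫ x in Ω, (y + z : L2 Ω) x * partialDeriv i θ x
      = ∫ x in Ω, (y x * partialDeriv i θ x + z x * partialDeriv i θ x) := by
    refine integral_congr_ae ?_
    filter_upwards [Lp.coeFn_add y z] with x hx
    rw [hx, Pi.add_apply, add_mul]
  have e2 : ∫ x in Ω, (g + h : L2Vec Ω) x i * θ x
      = ∫ x in Ω, (g x i * θ x + h x i * θ x) := by
    refine integral_congr_ae ?_
    filter_upwards [Lp.coeFn_add g h] with x hx
    rw [hx, Pi.add_apply, PiLp.add_apply, add_mul]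
  rw [e1, e2, integral_add (hθ.integrable_left y i) (hθ.integrable_left z i),
    integral_add (hθ.integrable_right g i) (hθ.integrable_right h i), hy θ hθ i, hz θ hθ i]
  ring

theorem HasWeakGradient.smul {d : ℕ} {Ω : Set (EuclideanSpace ℝ (Fin d))}
    {y : L2 Ω} {g : L2Vec Ω} (t : ℝ) (hy : HasWeakGradient y g) :
    HasWeakGradient (t • y) (t • g) := by
  intro θ hθ i
  have e1 : ∫ x in Ω, (t • y : L2 Ω) x * partialDeriv i θ x
      = ∫ x in Ω, t * (y x * partialDeriv i θ x) := by
    refine integral_congr_ae ?_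
    filter_upwards [Lp.coeFn_smul t y] with x hx
    rw [hx, Pi.smul_apply, smul_eq_mul, mul_assoc]
  have e2 : ∫ x in Ω, (t • g : L2Vec Ω) x i * θ x = ∫ x in Ω, t * (g x i * θ x) := by
    refine integral_congr_ae ?_
    filter_upwards [Lp.coeFn_smul t g] with x hx
    rw [hx, Pi.smul_apply, PiLp.smul_apply, smul_eq_mul, mul_assoc]
  rw [e1, e2, integral_const_mul, integral_const_mul, hy θ hθ i, mul_neg]

theorem HasWeakGradient.zero {d : ℕ} {Ω : Set (EuclideanSpace ℝ (Fin d))} :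
    HasWeakGradient (0 : L2 Ω) (0 : L2Vec Ω) := by
  intro θ hθ i
  have e1 : ∫ x in Ω, (0 : L2 Ω) x * partialDeriv i θ x = 0 := by
    refine integral_eq_zero_of_ae ?_
    filter_upwards [Lp.coeFn_zero ℝ 2 (volume.restrict Ω)] with x hx
    rw [hx]
    exact zero_mul _
  have e2 : ∫ x in Ω, (0 : L2Vec Ω) x i * θ x = 0 := by
    refine integral_eq_zero_of_ae ?_
    filter_upwards [Lp.coeFn_zero (EuclideanSpace ℝ (Fin d)) 2 (volume.restrict Ω)] with x hx
    rw [hx]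
    exact zero_mul _
  rw [e1, e2, neg_zero]

/-- On an open set the weak gradient is unique. -/
theorem HasWeakGradient.unique {d : ℕ} {Ω : Set (EuclideanSpace ℝ (Fin d))} (hΩ : IsOpen Ω)
    {y : L2 Ω} {g h : L2Vec Ω} (hg : HasWeakGradient y g) (hh : HasWeakGradient y h) :
    g = h := by
  have key : ∀ i : Fin d, ∀ᵐ x ∂(volume.restrict Ω), g x i - h x i = 0 := by
    intro i
    have hm : MemLp (fun x => g x i - h x i) 2 (volume.restrict Ω) :=
      (L2Vec.memLp_coord g i).sub (L2Vec.memLp_coord h i)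
    have hloc : LocallyIntegrableOn (fun x => g x i - h x i) Ω (volume.restrict Ω) :=
      (hm.locallyIntegrable (by norm_num)).locallyIntegrableOn Ω
    have := hΩ.ae_eq_zero_of_integral_contDiff_smul_eq_zero hloc (by
      intro θ h1 h2 h3
      have hθ : IsTestFunction Ω θ := ⟨h1, h2, h3⟩
      have e : ∫ x in Ω, θ x • (g x i - h x i)
          = ∫ x in Ω, (g x i * θ x - h x i * θ x) := by
        refine integral_congr_ae (Filter.Eventually.of_forall fun x => ?_)
        simp only [smul_eq_mul]
        ring
      rw [e, integral_sub (hθ.integrable_right g i) (hθ.integrable_right h i)]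
      have a := hg θ hθ i
      have b := hh θ hθ i
      linarith)
    filter_upwards [this, ae_restrict_mem hΩ.measurableSet] with x hx hxΩ using hx hxΩ
  refine Lp.ext ?_
  filter_upwards [ae_all_iff.2 key] with x hx
  ext i
  exact sub_eq_zero.1 (hx i)

/-- The Sobolev space `H¹(Ω)`, as a subspace of `L²(Ω)`. -/
def H1 {d : ℕ} (Ω : Set (EuclideanSpace ℝ (Fin d))) : Submodule ℝ (L2 Ω) where
  carrier := {y | ∃ g : L2Vec Ω, HasWeakGradient y g}
  add_mem' := by
    rintro y z ⟨g, hg⟩ ⟨h, hh⟩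
    exact ⟨g + h, hg.add hh⟩
  zero_mem' := ⟨0, HasWeakGradient.zero⟩
  smul_mem' := by
    rintro t y ⟨g, hg⟩
    exact ⟨t • g, hg.smul t⟩

/-- The weak gradient `∇y ∈ L²(Ω; ℝᵈ)` of `y ∈ H¹(Ω)`. -/
def weakGrad {d : ℕ} {Ω : Set (EuclideanSpace ℝ (Fin d))} (y : H1 Ω) : L2Vec Ω :=
  Classical.choose y.2

theorem weakGrad_spec {d : ℕ} {Ω : Set (EuclideanSpace ℝ (Fin d))} (y : H1 Ω) :
    HasWeakGradient (y : L2 Ω) (weakGrad y) :=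
  Classical.choose_spec y.2

/-- The bilinear form `a(u; y, ψ)` for the parameter `u = (κ₁, …, κ_m', c, r)`:
`∑ᵢ κᵢ ∫_{Ωᵢ} ∇y · ∇ψ dx + c ∫_Ω (b · ∇y) ψ dx + r ∫_Ω y ψ dx`. -/
def bilinForm {d m' : ℕ} {Ω : Set (EuclideanSpace ℝ (Fin d))}
    (Ωsub : Fin m' → Set (EuclideanSpace ℝ (Fin d))) (b : LinftyVec Ω)
    (κ : Fin m' → ℝ) (c r : ℝ) (y ψ : H1 Ω) : ℝ :=
  (∑ i, κ i * ∫ x in Ωsub i, inner ℝ (weakGrad y x) (weakGrad ψ x))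
    + c * (∫ x in Ω, inner ℝ (b x) (weakGrad y x) * (ψ : L2 Ω) x)
    + r * ∫ x in Ω, (y : L2 Ω) x * (ψ : L2 Ω) x

/-- The linear functional `F(ψ) = ⟨f, ψ⟩_{L²(Ω)}`. -/
def rhsFunctional {d : ℕ} {Ω : Set (EuclideanSpace ℝ (Fin d))} (f : L2 Ω) (ψ : H1 Ω) : ℝ :=
  inner ℝ f (ψ : L2 Ω)

/-- `y ∈ H¹(Ω)` solves the weak Neumann problem: `a(u; y, ψ) = F(ψ)` for all `ψ ∈ H¹(Ω)`. -/
def IsWeakSolution {d m' : ℕ} {Ω : Set (EuclideanSpace ℝ (Fin d))}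
    (Ωsub : Fin m' → Set (EuclideanSpace ℝ (Fin d))) (b : LinftyVec Ω) (f : L2 Ω)
    (κ : Fin m' → ℝ) (c r : ℝ) (y : H1 Ω) : Prop :=
  ∀ ψ : H1 Ω, bilinForm Ωsub b κ c r y ψ = rhsFunctional f ψ

/-- `Ω` is divided into the pairwise disjoint measurable parts `Ω₁, …, Ω_m'`. Interfaces of
measure zero may be left out, so that the parts may be open although `Ω` is connected. -/
structure IsSubdivision {d m' : ℕ} (Ω : Set (EuclideanSpace ℝ (Fin d)))
    (Ωsub : Fin m' → Set (EuclideanSpace ℝ (Fin d))) : Prop where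
  measurable : ∀ i, MeasurableSet (Ωsub i)
  subset : ∀ i, Ωsub i ⊆ Ω
  disjoint : Pairwise fun i j => Disjoint (Ωsub i) (Ωsub j)
  cover : volume (Ω \ ⋃ i, Ωsub i) = 0

end

noncomputable section

/-! The proof applies Lax–Milgram to the graph of the weak gradient, a closed subspace of `L²(Ω) ×
L²(Ω; ℝᵈ)` and so a Hilbert space. Since `Ω` is open, weak gradients are unique and `y ↦ (y, ∇y)` is
a bijection from `H1 Ω` onto this graph.

The form is already coercive on the whole product, with the gradient replaced by an independent `g`.
If `k` bounds all `κ i` and `r` from below, diffusion and reaction give at least `k (‖y‖² + ‖g‖²)`.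
With `A = advection b`, the advection term is at most `|c| ‖A‖ ‖g‖ ‖y‖ ≤ (|c| ‖A‖ / 2) (‖y‖² +
‖g‖²)` in absolute value. Hence `|c| ‖A‖ / 2 < k` suffices (`IsSubdivision.le_pairForm_self`). -/

/-- The Hilbert space `L²(Ω) × L²(Ω; ℝᵈ)`. -/
abbrev L2Pair {d : ℕ} (Ω : Set (EuclideanSpace ℝ (Fin d))) : Type :=
  WithLp 2 (L2 Ω × L2Vec Ω)

/-- The graph of the weak gradient; it is `H¹(Ω)` with its Hilbert space structure. -/
def weakGradGraph {d : ℕ} (Ω : Set (EuclideanSpace ℝ (Fin d))) : Submodule ℝ (L2Pair Ω) where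
  carrier := {p | HasWeakGradient p.fst p.snd}
  add_mem' := HasWeakGradient.add
  zero_mem' := HasWeakGradient.zero
  smul_mem' t _ h := h.smul t

/-- For fixed `θ` and `i`, both sides of the defining identity are `L²` inner products with a fixed
function, hence continuous in the pair. The graph is an intersection of equalizers of continuous
maps. -/
theorem isClosed_weakGradGraph {d : ℕ} (Ω : Set (EuclideanSpace ℝ (Fin d))) :
    IsClosed (weakGradGraph Ω : Set (L2Pair Ω)) := by
  have heq : (weakGradGraph Ω : Set (L2Pair Ω)) =
      ⋂ (θ : EuclideanSpace ℝ (Fin d) → ℝ) (hθ : IsTestFunction Ω θ) (i : Fin d),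
        {p : L2Pair Ω | inner ℝ p.fst (hθ.memLp_partialDeriv i).toLp
          = - inner ℝ ((EuclideanSpace.proj (𝕜 := ℝ) i).compLpL 2 (volume.restrict Ω) p.snd)
              hθ.memLp.toLp} := by
    ext p
    simp only [Set.mem_iInter, Set.mem_ofPred_eq]
    refine forall_congr' fun θ => forall_congr' fun hθ => forall_congr' fun i => ?_
    have e1 : inner ℝ p.fst (hθ.memLp_partialDeriv i).toLp
        = ∫ x in Ω, p.fst x * partialDeriv i θ x := by
      rw [L2.inner_def]
      refine integral_congr_ae ?_
      filter_upwards [(hθ.memLp_partialDeriv i).coeFn_toLp] with x hx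
      rw [hx, real_inner_eq_re_inner, RCLike.inner_apply]
      simp [mul_comm]
    have e2 : inner ℝ ((EuclideanSpace.proj (𝕜 := ℝ) i).compLpL 2 (volume.restrict Ω) p.snd)
        hθ.memLp.toLp = ∫ x in Ω, p.snd x i * θ x := by
      rw [L2.inner_def]
      refine integral_congr_ae ?_
      filter_upwards [hθ.memLp.coeFn_toLp,
        (EuclideanSpace.proj (𝕜 := ℝ) i).coeFn_compLpL p.snd] with x hx hx'
      rw [hx, hx', real_inner_eq_re_inner, RCLike.inner_apply]
      simp [mul_comm]
    rw [e1, e2]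
  rw [heq]
  refine isClosed_iInter fun θ => isClosed_iInter fun hθ => isClosed_iInter fun i =>
    isClosed_eq ?_ ?_
  · exact (WithLp.continuous_fst 2 _ _).inner continuous_const
  · exact ((((EuclideanSpace.proj (𝕜 := ℝ) i).compLpL 2
      (volume.restrict Ω)).continuous.comp (WithLp.continuous_snd 2 _ _)).inner
        continuous_const).neg

/-! ### Advection and diffusion on `L²` -/

/-- The bounded operator `g ↦ b · g` from `L²(Ω; ℝᵈ)` to `L²(Ω)`. -/
def advection {d : ℕ} {Ω : Set (EuclideanSpace ℝ (Fin d))} (b : LinftyVec Ω) :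
    L2Vec Ω →L[ℝ] L2 Ω :=
  (innerSL ℝ).holderL (volume.restrict Ω) ⊤ 2 2 b

theorem coeFn_advection {d : ℕ} {Ω : Set (EuclideanSpace ℝ (Fin d))} (b : LinftyVec Ω)
    (g : L2Vec Ω) : advection b g =ᵐ[volume.restrict Ω] fun x => inner ℝ (b x) (g x) :=
  (innerSL ℝ).coeFn_holder (r := 2) b g

/-- The continuous bilinear form `∑ᵢ κᵢ ∫_{Ωᵢ} g · h dx` on `L²(Ω; ℝᵈ)`. -/
def diffusion {d m' : ℕ} {Ω : Set (EuclideanSpace ℝ (Fin d))}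
    (Ωsub : Fin m' → Set (EuclideanSpace ℝ (Fin d))) (κ : Fin m' → ℝ) :
    L2Vec Ω →L[ℝ] L2Vec Ω →L[ℝ] ℝ :=
  ∑ i, κ i • (innerSL ℝ).bilinearComp
    (LpToLpRestrictCLM _ (EuclideanSpace ℝ (Fin d)) ℝ (volume.restrict Ω) 2 (Ωsub i))
    (LpToLpRestrictCLM _ (EuclideanSpace ℝ (Fin d)) ℝ (volume.restrict Ω) 2 (Ωsub i))

theorem IsSubdivision.diffusion_apply {d m' : ℕ} {Ω : Set (EuclideanSpace ℝ (Fin d))}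
    {Ωsub : Fin m' → Set (EuclideanSpace ℝ (Fin d))} (hsub : IsSubdivision Ω Ωsub)
    (κ : Fin m' → ℝ) (g h : L2Vec Ω) :
    diffusion Ωsub κ g h = ∑ i, κ i * ∫ x in Ωsub i, inner ℝ (g x) (h x) := by
  simp only [diffusion, sum_apply, smul_apply, ContinuousLinearMap.bilinearComp_apply,
    innerSL_apply_apply, smul_eq_mul, L2.inner_def]
  refine Finset.sum_congr rfl fun i _ => ?_
  congr 1
  -- As `Ωsub i ⊆ Ω`, restricting Lebesgue measure to `Ω` and then to `Ωsub i` is the same as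
  -- restricting it to `Ωsub i`.
  refine (integral_congr_ae ?_).trans
    (congrArg (∫ x, inner ℝ (g x) (h x) ∂·) (Measure.restrict_restrict_of_subset (hsub.subset i)))
  filter_upwards [LpToLpRestrictCLM_coeFn ℝ (Ωsub i) g,
    LpToLpRestrictCLM_coeFn ℝ (Ωsub i) h] with x hg hh
  rw [hg, hh]

/-- Disjointness gives the integral over the union of the parts, which differs from `Ω` by a null
set. -/
theorem IsSubdivision.sum_setIntegral {d m' : ℕ} {Ω : Set (EuclideanSpace ℝ (Fin d))}
    {Ωsub : Fin m' → Set (EuclideanSpace ℝ (Fin d))} (hsub : IsSubdivision Ω Ωsub)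
    {φ : EuclideanSpace ℝ (Fin d) → ℝ} (hφ : IntegrableOn φ Ω) :
    ∑ i, ∫ x in Ωsub i, φ x = ∫ x in Ω, φ x := by
  rw [← integral_iUnion_fintype hsub.measurable hsub.disjoint
    fun i => hφ.mono_set (hsub.subset i)]
  refine setIntegral_congr_set ?_
  refine Filter.EventuallyLE.antisymm (Set.iUnion_subset hsub.subset).eventuallyLE ?_
  exact ae_le_set.2 hsub.cover

/-- `‖g‖ ^ 2` splits into the integrals of `|g|²` over the parts; these are nonnegative, so the
bound holds part by part. -/
theorem IsSubdivision.le_diffusion {d m' : ℕ} {Ω : Set (EuclideanSpace ℝ (Fin d))}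
    {Ωsub : Fin m' → Set (EuclideanSpace ℝ (Fin d))} (hsub : IsSubdivision Ω Ωsub)
    {κ : Fin m' → ℝ} {k : ℝ} (hκ : ∀ i, k ≤ κ i) (g : L2Vec Ω) :
    k * ‖g‖ ^ 2 ≤ diffusion Ωsub κ g g := by
  rw [hsub.diffusion_apply, ← real_inner_self_eq_norm_sq, L2.inner_def,
    ← hsub.sum_setIntegral (L2.integrable_inner g g), Finset.mul_sum]
  exact Finset.sum_le_sum fun i _ => mul_le_mul_of_nonneg_right (hκ i)
    (integral_nonneg fun x => real_inner_self_nonneg)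

/-- The form `a(u; ·, ·)` on `L²(Ω) × L²(Ω; ℝᵈ)`, the gradients being independent variables. -/
def pairForm {d m' : ℕ} {Ω : Set (EuclideanSpace ℝ (Fin d))}
    (Ωsub : Fin m' → Set (EuclideanSpace ℝ (Fin d))) (b : LinftyVec Ω)
    (κ : Fin m' → ℝ) (c r : ℝ) : L2Pair Ω →L[ℝ] L2Pair Ω →L[ℝ] ℝ :=
  let fst : L2Pair Ω →L[ℝ] L2 Ω := WithLp.fstL 2 ℝ (L2 Ω) (L2Vec Ω)
  let snd : L2Pair Ω →L[ℝ] L2Vec Ω := WithLp.sndL 2 ℝ (L2 Ω) (L2Vec Ω)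
  let inn : L2 Ω →L[ℝ] L2 Ω →L[ℝ] ℝ := innerSL ℝ
  (diffusion Ωsub κ).bilinearComp snd snd + c • inn.bilinearComp (advection b ∘L snd) fst
    + r • inn.bilinearComp fst fst

theorem pairForm_apply {d m' : ℕ} {Ω : Set (EuclideanSpace ℝ (Fin d))}
    (Ωsub : Fin m' → Set (EuclideanSpace ℝ (Fin d))) (b : LinftyVec Ω)
    (κ : Fin m' → ℝ) (c r : ℝ) (p q : L2Pair Ω) :
    pairForm Ωsub b κ c r p q = diffusion Ωsub κ p.snd q.snd
      + c * inner ℝ (advection b p.snd) q.fst + r * inner ℝ p.fst q.fst :=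
  rfl

/-! ### Identification of `H¹(Ω)` with the graph -/

/-- The element `(y, ∇y)` of the graph. -/
def H1.toGraph {d : ℕ} {Ω : Set (EuclideanSpace ℝ (Fin d))} (y : H1 Ω) : weakGradGraph Ω :=
  ⟨WithLp.toLp 2 ((y : L2 Ω), weakGrad y), weakGrad_spec y⟩

theorem H1.toGraph_injective {d : ℕ} {Ω : Set (EuclideanSpace ℝ (Fin d))} :
    Function.Injective (H1.toGraph (Ω := Ω)) := fun _ _ h =>
  Subtype.ext (congrArg (fun p : weakGradGraph Ω => (p : L2Pair Ω).fst) h)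

/-- `weakGrad` is a chosen gradient; uniqueness on an open set forces it to be the second component
of the given pair. -/
theorem H1.toGraph_surjective {d : ℕ} {Ω : Set (EuclideanSpace ℝ (Fin d))} (hΩ : IsOpen Ω) :
    Function.Surjective (H1.toGraph (Ω := Ω)) := fun p =>
  ⟨⟨(p : L2Pair Ω).fst, (p : L2Pair Ω).snd, p.2⟩, Subtype.ext <| WithLp.ofLp_injective 2 <|
    Prod.ext rfl ((weakGrad_spec _).unique hΩ p.2)⟩

theorem IsSubdivision.pairForm_toGraph {d m' : ℕ} {Ω : Set (EuclideanSpace ℝ (Fin d))}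
    {Ωsub : Fin m' → Set (EuclideanSpace ℝ (Fin d))} (hsub : IsSubdivision Ω Ωsub)
    (b : LinftyVec Ω) (κ : Fin m' → ℝ) (c r : ℝ) (y ψ : H1 Ω) :
    pairForm Ωsub b κ c r (H1.toGraph y) (H1.toGraph ψ) = bilinForm Ωsub b κ c r y ψ := by
  have e1 : inner ℝ (advection b (weakGrad y)) (ψ : L2 Ω)
      = ∫ x in Ω, inner ℝ (b x) (weakGrad y x) * (ψ : L2 Ω) x := by
    rw [L2.inner_def]
    refine integral_congr_ae ?_
    filter_upwards [coeFn_advection b (weakGrad y)] with x hx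
    rw [hx]
    exact mul_comm _ _
  have e2 : inner ℝ (y : L2 Ω) (ψ : L2 Ω) = ∫ x in Ω, (y : L2 Ω) x * (ψ : L2 Ω) x := by
    rw [L2.inner_def]
    exact integral_congr_ae (.of_forall fun x => mul_comm _ _)
  rw [pairForm_apply, bilinForm, ← e1, ← e2, ← hsub.diffusion_apply]
  rfl

/-! ### Coercivity and Lax–Milgram -/

/-- Coercivity estimate, in terms of the norm of the advection operator. -/
theorem IsSubdivision.le_pairForm_self {d m' : ℕ} {Ω : Set (EuclideanSpace ℝ (Fin d))}
    {Ωsub : Fin m' → Set (EuclideanSpace ℝ (Fin d))} (hsub : IsSubdivision Ω Ωsub)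
    {b : LinftyVec Ω} {κ : Fin m' → ℝ} {c r k : ℝ} (hκ : ∀ i, k ≤ κ i) (hr : k ≤ r)
    (p : L2Pair Ω) :
    (k - |c| * ‖advection b‖ / 2) * ‖p‖ ^ 2 ≤ pairForm Ωsub b κ c r p p := by
  have h1 := hsub.le_diffusion hκ p.snd
  have h2 : |c * inner ℝ (advection b p.snd) p.fst|
      ≤ |c| * ‖advection b‖ * (‖p.snd‖ * ‖p.fst‖) := by
    rw [abs_mul, mul_assoc]
    refine mul_le_mul_of_nonneg_left ?_ (abs_nonneg c)
    rw [← mul_assoc]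
    exact (abs_real_inner_le_norm _ _).trans
      (mul_le_mul_of_nonneg_right ((advection b).le_opNorm _) (norm_nonneg _))
  -- Young's inequality, the source of the factor `1 / 2` in the coercivity constant.
  have h3 : |c| * ‖advection b‖ * (‖p.snd‖ * ‖p.fst‖)
      ≤ |c| * ‖advection b‖ * ((‖p.fst‖ ^ 2 + ‖p.snd‖ ^ 2) / 2) :=
    mul_le_mul_of_nonneg_left (by linarith [two_mul_le_add_sq ‖p.snd‖ ‖p.fst‖])
      (by positivity)
  have h4 : k * ‖p.fst‖ ^ 2 ≤ r * ‖p.fst‖ ^ 2 := mul_le_mul_of_nonneg_right hr (sq_nonneg _)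
  have h5 := (abs_le.1 (h2.trans h3)).1
  rw [pairForm_apply, real_inner_self_eq_norm_sq, WithLp.prod_norm_sq_eq_of_L2]
  linarith

/-- The Lax–Milgram isomorphism represents `B` through the inner product, so the equation says that
it sends `v` to the Riesz representative of `F`. -/
theorem IsCoercive.existsUnique_eq {V : Type*} [NormedAddCommGroup V] [InnerProductSpace ℝ V]
    [CompleteSpace V] {B : V →L[ℝ] V →L[ℝ] ℝ} (hB : IsCoercive B) (F : V →L[ℝ] ℝ) :
    ∃! v, ∀ w, B v w = F w := by
  have key : ∀ v, (∀ w, B v w = F w) ↔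
      hB.continuousLinearEquivOfBilin v = (InnerProductSpace.toDual ℝ V).symm F := fun v => by
    refine ⟨fun h => ext_inner_right ℝ fun w => ?_, fun h w => ?_⟩
    · rw [hB.continuousLinearEquivOfBilin_apply, InnerProductSpace.toDual_symm_apply, h]
    · rw [← hB.continuousLinearEquivOfBilin_apply, h, InnerProductSpace.toDual_symm_apply]
  simp only [key]
  exact hB.continuousLinearEquivOfBilin.bijective.existsUnique _

theorem IsSubdivision.existsUnique_isWeakSolution {d m' : ℕ}
    {Ω : Set (EuclideanSpace ℝ (Fin d))} (hΩ : IsOpen Ω)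
    {Ωsub : Fin m' → Set (EuclideanSpace ℝ (Fin d))} (hsub : IsSubdivision Ω Ωsub)
    {b : LinftyVec Ω} (f : L2 Ω) {κ : Fin m' → ℝ} {c r k : ℝ} (hκ : ∀ i, k ≤ κ i)
    (hr : k ≤ r) (hc : |c| * ‖advection b‖ / 2 < k) :
    ∃! y : H1 Ω, IsWeakSolution Ωsub b f κ c r y := by
  have : CompleteSpace (weakGradGraph Ω) := (isClosed_weakGradGraph Ω).completeSpace_coe
  let B := (pairForm Ωsub b κ c r).bilinearComp (weakGradGraph Ω).subtypeL
    (weakGradGraph Ω).subtypeL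
  let F : weakGradGraph Ω →L[ℝ] ℝ :=
    innerSL ℝ f ∘L WithLp.fstL 2 ℝ (L2 Ω) (L2Vec Ω) ∘L (weakGradGraph Ω).subtypeL
  have hB : IsCoercive B := by
    refine ⟨k - |c| * ‖advection b‖ / 2, sub_pos.2 hc, fun p => ?_⟩
    rw [mul_assoc, ← sq]
    exact hsub.le_pairForm_self hκ hr (p : L2Pair Ω)
  have key : ∀ y : H1 Ω, IsWeakSolution Ωsub b f κ c r y ↔
      ∀ q, B (H1.toGraph y) q = F q := fun y => by
    rw [(H1.toGraph_surjective hΩ).forall]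
    refine forall_congr' fun ψ => ?_
    rw [← hsub.pairForm_toGraph]
    rfl
  simp only [key]
  obtain ⟨p, hp, hp'⟩ := hB.existsUnique_eq F
  obtain ⟨y, rfl⟩ := H1.toGraph_surjective hΩ p
  exact ⟨y, hp, fun z hz => H1.toGraph_injective (hp' _ hz)⟩

end

theorem mainTheorem5 {d : ℕ} (hd : d = 2 ∨ d = 3) {m' : ℕ}
    (Ω : Set (EuclideanSpace ℝ (Fin d))) (hΩ_open : IsOpen Ω) (hΩ_conn : IsConnected Ω)
    (Ωsub : Fin m' → Set (EuclideanSpace ℝ (Fin d))) (hsub : IsSubdivision Ω Ωsub)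
    (b : LinftyVec Ω) (f : L2 Ω) :
    ∃ (κmin : Fin m' → ℝ) (cmin cmax rmin : ℝ),
      (∀ i, 0 < κmin i) ∧ cmin < cmax ∧ 0 < rmin ∧
      ∀ (κ : Fin m' → ℝ) (c r : ℝ),
        (∀ i, κmin i < κ i) → cmin < c → c < cmax → rmin < r →
        ∃! y : H1 Ω, IsWeakSolution Ωsub b f κ c r y := by
  have hk : 0 < ‖advection b‖ + 1 := by positivity
  -- For `|c| < 1` the advection loss is at most `‖advection b‖ / 2`. The `+ 1` keeps the thresholds
  -- positive even if `advection b = 0`.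
  refine ⟨fun _ => ‖advection b‖ + 1, -1, 1, ‖advection b‖ + 1, fun _ => hk, by norm_num, hk,
    fun κ c r hκ hc1 hc2 hr =>
      hsub.existsUnique_isWeakSolution hΩ_open f (fun i => (hκ i).le) hr.le ?_⟩
  have := mul_le_of_le_one_left (norm_nonneg (advection b)) (abs_lt.2 ⟨hc1, hc2⟩).le
  linarith [norm_nonneg (advection b)]
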